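/- Let $\Sigma$ be a compact Riemann surface with distinct marked points $z_1,\dots,z_k$ and multiplicities $m_1,\dots,m_k\ge 1$, and let $\tilde\Sigma$ be the orbifold Riemann surface on $\Sigma$ which is uniformized near $z_i$ by $z\mapsto u=z^{m_i}$, with the group $\mathbb Z/m_i$ of $m_i$-th roots of unity acting by multiplication. Let $r\ge 2$, let $L$ be a holomorphic orbifold line bundle on $\tilde\Sigma$, and let $\varphi:L^r\to K_{\log}$ be an isomorphism of holomorphic orbifold line bundles, where $K_{\log}=K_\Sigma\otimes\mathcal O(z_1)\otimes\cdots\otimes\mathcal O(z_k)$ is pulled back to $\tilde\Sigma$. Near $z_i$ the bundle $L$ is $(D\times\mathbb C)/(\mathbb Z/m_i)$, where $\zeta\in\mathbb Z/m_i$ acts by $(z,w)\mapsto(\zeta z,\zeta^{d_i}w)$ and $0\le d_i<m_i$. Suppose that every marked point is Neveu–Schwarz for $L$, that is, $d_i>0$ for all $i$. Let $|L|$ be the desingularization of $L$: the line bundle on $\Sigma$ which equals $L$ away from the marked points and is trivialized near $z_i$ by $(z,w)\mapsto(z^{m_i},z^{-d_i}w)$, so that a section of $|L|$ with local representative $g(u)$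 corresponds to the section $z^{d_i}g(z^{m_i})$ of $L$. Fix a smooth Hermitian metric on $L=|L|$ over $\Sigma\setminus\{z_1,\dots,z_k\}$, for example the restriction of a smooth metric on $|L|$ over $\Sigma$ or of an orbifold metric on $L$. For a smooth section $s$ of $|L|$ over $\Sigma$, the isomorphism $\varphi$ makes $s^{r-1}$ a section of $K\otimes L^{-1}$ over $\Sigma\setminus\{z_1,\dots,z_k\}$, and $\bar s^{\,r-1}$ denotes its conjugate, a section of $\bar K\otimes\bar L^{-1}$, regarded as a $(0,1)$-form with values in $L$ by means of the identification $\bar L^{-1}\cong L$ given by the metric. Then, for every smooth section $s$ of $|L|$ over $\Sigma$, the spin equation $$\bar\partial s+\bar s^{\,r-1}=0\quad\text{on }\Sigma\setminus\{z_1,\dots,z_k\}$$ holds if and only if $s=0$ on $\Sigma$. (If the metric is a smooth metric on $|L|$ over $\Sigma$, then both terms of the equation are smooth on all of $\Sigma$, and it is equivalent to require the equation on all of $\Sigma$.) -/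

import Mathlib

open scoped Manifold ContDiff

noncomputable section

namespace SpinCurve

/-- Orbifold data on a Riemann surface `X`: finitely many distinct marked points `pt i`, and
multiplicities `mult i ≥ 1`.  Near `pt i` the orbifold is uniformized by `z ↦ z ^ mult i` with the
`mult i`-th roots of unity acting by multiplication; elsewhere the orbifold structure is trivial. -/
structure OrbifoldStructure (X : Type*) where
  /-- the number of marked points -/
  k : ℕ
  /-- the marked points -/
  pt : Fin k → X
  pt_injective : Function.Injective pt
  /-- the orders of the local groups at the marked points -/
  mult : Fin k → ℕ
  one_le_mult : ∀ i, 1 ≤ mult i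

namespace OrbifoldStructure

variable {X : Type*} (O : OrbifoldStructure X)

/-- The set of marked points. -/
def marked : Set X := Set.range O.pt

open Classical in
/-- The order of the local group at `p`: it is `mult i` at `pt i` and `1` at unmarked points. -/
def ord (p : X) : ℕ := if h : ∃ i, O.pt i = p then O.mult h.choose else 1

theorem ord_pt (i : Fin O.k) : O.ord (O.pt i) = O.mult i := by
  have h : ∃ j, O.pt j = O.pt i := ⟨i, rfl⟩
  rw [ord, dif_pos h, O.pt_injective h.choose_spec]

theorem ord_of_not_marked {p : X} (hp : p ∉ O.marked) : O.ord p = 1 := dif_neg hp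

theorem one_le_ord (p : X) : 1 ≤ O.ord p := by
  unfold ord
  split_ifs with h
  · exact O.one_le_mult _
  · exact le_rfl

end OrbifoldStructure

section Charts

variable {X : Type*} [TopologicalSpace X] [ChartedSpace ℂ X]

/-- A uniformizing chart of the orbifold: a holomorphic coordinate `u` on an open set of `X`
which vanishes at `center`, where no point of the open set other than `center` is marked.  With
`m` the order of the local group at `center`, the set `cover = {z | z ^ m ∈ u.target}` uniformizes
the open set through `proj z = u⁻¹ (z ^ m)`. -/
structure OrbiChart (O : OrbifoldStructure X) where
  /-- the centre of the chart -/
  center : X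
  /-- the coordinate on the underlying Riemann surface -/
  u : OpenPartialHomeomorph X ℂ
  mem_maximalAtlas : u ∈ IsManifold.maximalAtlas 𝓘(ℂ, ℂ) ω X
  center_mem : center ∈ u.source
  u_center : u center = 0
  eq_center : ∀ p ∈ u.source, p ∈ O.marked → p = center

namespace OrbiChart

variable {O : OrbifoldStructure X} (c : OrbiChart O)

/-- The order of the local group of the chart. -/
def ord : ℕ := O.ord c.center

/-- The uniformizing open subset of `ℂ`. -/
def cover : Set ℂ := {z | z ^ c.ord ∈ c.u.target}

/-- The uniformizing map onto the coordinate neighbourhood. -/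
def proj (z : ℂ) : X := c.u.symm (z ^ c.ord)

open Classical in
/-- The frame of `K_log` on the chart is `logFactor u • du`: it is `du / u` if the centre is marked,
and `du` otherwise. -/
def logFactor (u : ℂ) : ℂ := if c.center ∈ O.marked then u⁻¹ else 1

end OrbiChart

/-- An atlas of uniformizing charts, indexed by `ι`. -/
structure OrbiAtlas (O : OrbifoldStructure X) (ι : Type*) where
  /-- the charts -/
  chart : ι → OrbiChart O
  covers : ∀ p : X, ∃ a, p ∈ (chart a).u.source

variable {O : OrbifoldStructure X} {ι : Type*} (A : OrbiAtlas O ι)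

/-- The points `z`, `w` of the uniformizing sets of the charts `a`, `b` lie over the same point of
the surface, and this point is not marked. -/
def OrbiAtlas.Over (a b : ι) (z w : ℂ) : Prop :=
  z ∈ (A.chart a).cover ∧ w ∈ (A.chart b).cover ∧
    (A.chart a).proj z = (A.chart b).proj w ∧ (A.chart a).proj z ∉ O.marked

/-- A holomorphic orbifold line bundle, given by its local trivializations `cover a × ℂ` and its
transition functions.  Over the chart `a`, a root of unity `ζ` of the local group acts by
`(z, w) ↦ (ζ z, ζ ^ (weight a) w)`.  A section has local representatives `f a` on `cover a` with
`f a z = g a b z w * f b w` whenever `z` and `w` lie over the same point. -/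
structure OrbiLineBundle where
  /-- the weights of the actions of the local groups (only their residue modulo `ord` matters) -/
  weight : ι → ℕ
  /-- the transition functions (off the marked points, where all lifts are distinct) -/
  g : ι → ι → ℂ → ℂ → ℂ
  g_ne_zero : ∀ a b z w, A.Over a b z w → g a b z w ≠ 0
  g_cocycle : ∀ a b c z w v, A.Over a b z w → A.Over b c w v →
    g a b z w * g b c w v = g a c z v
  /-- sections satisfy `f a (ζ z) = ζ ^ (weight a) * f a z` -/
  g_action : ∀ a z ζ, z ∈ (A.chart a).cover → (A.chart a).proj z ∉ O.marked →
    ζ ^ (A.chart a).ord = 1 → g a a (ζ * z) z = ζ ^ weight a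
  /-- along each holomorphic lift `l` of a change of charts, the transition function is holomorphic
  without zeros, also across the points over a marked point -/
  g_holo : ∀ (a b : ι) (V : Set ℂ) (l : ℂ → ℂ), IsOpen V → V ⊆ (A.chart a).cover →
    DifferentiableOn ℂ l V → Set.MapsTo l V (A.chart b).cover →
    (∀ z ∈ V, (A.chart b).proj (l z) = (A.chart a).proj z) →
    ∃ G : ℂ → ℂ, DifferentiableOn ℂ G V ∧ (∀ z ∈ V, G z ≠ 0) ∧
      ∀ z ∈ V, (A.chart a).proj z ∉ O.marked → g a b z (l z) = G z

namespace OrbiLineBundle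

variable {A}

/-- The tensor power `L ^ r`. -/
def pow (L : OrbiLineBundle A) (r : ℕ) : OrbiLineBundle A where
  weight a := L.weight a * r
  g a b z w := L.g a b z w ^ r
  g_ne_zero a b z w h := pow_ne_zero _ (L.g_ne_zero a b z w h)
  g_cocycle a b c z w v h h' := by rw [← mul_pow, L.g_cocycle a b c z w v h h']
  g_action a z ζ hz hm hζ := by rw [L.g_action a z ζ hz hm hζ, pow_mul]
  g_holo a b V l hV hVa hl hlb hp := by
    obtain ⟨G, hG, hG0, hGe⟩ := L.g_holo a b V l hV hVa hl hlb hp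
    exact ⟨fun z => G z ^ r, hG.pow r, fun z hz => pow_ne_zero _ (hG0 z hz),
      fun z hz hm => by rw [hGe z hz hm]⟩

/-- An isomorphism of holomorphic orbifold line bundles: in each chart, multiplication of the local
representatives by a holomorphic function without zeros, compatibly with the transition functions
(in particular equivariantly). -/
structure Iso (L M : OrbiLineBundle A) where
  /-- the local expressions `f a ↦ toFun a * f a` -/
  toFun : ι → ℂ → ℂ
  holo : ∀ a, DifferentiableOn ℂ (toFun a) (A.chart a).cover
  ne_zero : ∀ a, ∀ z ∈ (A.chart a).cover, toFun a z ≠ 0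
  compat : ∀ a b z w, A.Over a b z w → toFun a z * L.g a b z w = M.g a b z w * toFun b w

/-- The representative in `[0, m)` of the weight of the local group (of order `m`) on the fibre
over the centre of the chart `a`. -/
def wt (L : OrbiLineBundle A) (a : ι) : ℕ := L.weight a % (A.chart a).ord

/-- All marked points are Neveu–Schwarz for `L`: the local group at each of them acts on the fibre
with nonzero weight. -/
def AllNeveuSchwarz (L : OrbiLineBundle A) : Prop :=
  ∀ a, (A.chart a).center ∈ O.marked → 0 < L.wt a

/-- A smooth section of the desingularization `|L|`, the line bundle on `X` which is trivialized on
the chart `a` by `(z, w) ↦ (z ^ m, z ^ (-d) w)`, where `m` is the order of the local group and `d`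
the weight in `[0, m)`.  Its representative on `a` is a smooth function `toFun a` on the range of
the coordinate `u`, and the corresponding representative of a section of `L` is
`z ↦ z ^ d * toFun a (z ^ m)`. -/
structure SmoothSection (L : OrbiLineBundle A) where
  /-- the local representatives -/
  toFun : ι → ℂ → ℂ
  smooth : ∀ a, ContDiffOn ℝ ∞ (toFun a) (A.chart a).u.target
  compat : ∀ a b z w, A.Over a b z w →
    z ^ L.wt a * toFun a (z ^ (A.chart a).ord) =
      L.g a b z w * (w ^ L.wt b * toFun b (w ^ (A.chart b).ord))

/-- The section of `L` which corresponds to a section of `|L|`, in the chart `a`. -/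
def SmoothSection.lift {L : OrbiLineBundle A} (s : L.SmoothSection) (a : ι) (z : ℂ) : ℂ :=
  z ^ L.wt a * s.toFun a (z ^ (A.chart a).ord)

/-- The section vanishes identically on `X` (marked points included). -/
def SmoothSection.IsZero {L : OrbiLineBundle A} (s : L.SmoothSection) : Prop :=
  ∀ a, ∀ u ∈ (A.chart a).u.target, s.toFun a u = 0

/-- A smooth Hermitian metric on `L = |L|` over the complement of the marked points, with the
squared norm `weight a z * ‖f a z‖ ^ 2` of a section.  The behaviour at the marked points is left
free, so that the two kinds of metrics in use are both covered: an orbifold metric on `L`, where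
`weight a` is smooth and positive on all of `cover a`, and a smooth metric on the line bundle `|L|`
over `X`, where `weight a z = h (z ^ m) / ‖z ^ d‖ ^ 2` with `h` smooth and positive on all of the
range of the coordinate. -/
structure HermitianMetric (L : OrbiLineBundle A) where
  /-- the squared norms of the local frames -/
  weight : ι → ℂ → ℝ
  smooth : ∀ a, ContDiffOn ℝ ∞ (weight a)
    {z | z ∈ (A.chart a).cover ∧ (A.chart a).proj z ∉ O.marked}
  pos : ∀ a, ∀ z ∈ (A.chart a).cover, (A.chart a).proj z ∉ O.marked → 0 < weight a z
  compat : ∀ a b z w, A.Over a b z w → weight a z * ‖L.g a b z w‖ ^ 2 = weight b w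

end OrbiLineBundle

theorem OrbiChart.logFactor_ne_zero (c : OrbiChart O) {u : ℂ} (hu : c.u.symm u ∉ O.marked) :
    c.logFactor u ≠ 0 := by
  unfold OrbiChart.logFactor
  split_ifs with h
  · refine inv_ne_zero ?_
    rintro rfl
    rw [← c.u_center, c.u.left_inv c.center_mem] at hu
    exact hu h
  · exact one_ne_zero

theorem OrbiChart.logFactor_differentiableOn (c : OrbiChart O) :
    DifferentiableOn ℂ c.logFactor {u | c.u.symm u ∉ O.marked} := by
  unfold OrbiChart.logFactor
  split_ifs with h
  · refine differentiableOn_inv.mono ?_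
    rintro u hu rfl
    apply hu
    rw [← c.u_center, c.u.left_inv c.center_mem]
    exact h
  · exact differentiableOn_const _

section Klog

/-- The change of coordinates (on the surface) from the chart `a` to the chart `b`. -/
def OrbiAtlas.trans (a b : ι) (u : ℂ) : ℂ := (A.chart b).u ((A.chart a).u.symm u)

/-- The domain of the change of coordinates. -/
def OrbiAtlas.dom (a b : ι) : Set ℂ := (A.chart a).u.target ∩ (A.chart a).u.symm ⁻¹' (A.chart b).u.source

theorem OrbiAtlas.isOpen_dom (a b : ι) : IsOpen (A.dom a b) :=
  (A.chart a).u.isOpen_inter_preimage_symm (A.chart b).u.open_source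

theorem OrbiAtlas.trans_differentiableOn (a b : ι) :
    DifferentiableOn ℂ (A.trans a b) (A.dom a b) := by
  have h1 := contMDiffOn_of_mem_maximalAtlas (A.chart b).mem_maximalAtlas
  have h2 := contMDiffOn_symm_of_mem_maximalAtlas (A.chart a).mem_maximalAtlas
  have h3 : ContMDiffOn 𝓘(ℂ, ℂ) 𝓘(ℂ, ℂ) ω (A.trans a b) (A.dom a b) :=
    h1.comp (h2.mono Set.inter_subset_left) (fun z hz => hz.2)
  exact (contMDiffOn_iff_contDiffOn.1 h3).differentiableOn (by simp)

theorem OrbiAtlas.deriv_trans_self (a : ι) {u : ℂ} (hu : u ∈ (A.chart a).u.target) :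
    deriv (A.trans a a) u = 1 := by
  have h : A.trans a a =ᶠ[nhds u] id := by
    filter_upwards [(A.chart a).u.open_target.mem_nhds hu] with v hv
    exact (A.chart a).u.right_inv hv
  rw [h.deriv_eq, deriv_id]

theorem OrbiAtlas.trans_mem_dom (a b c : ι) {u : ℂ} (hu : u ∈ A.dom a b) (hc : u ∈ A.dom a c) :
    A.trans a b u ∈ A.dom b c := by
  refine ⟨(A.chart b).u.map_source hu.2, ?_⟩
  simp only [Set.mem_preimage, OrbiAtlas.trans]
  rw [(A.chart b).u.left_inv hu.2]
  exact hc.2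

theorem OrbiAtlas.deriv_trans_comp (a b c : ι) {u : ℂ} (hu : u ∈ A.dom a b) (hc : u ∈ A.dom a c) :
    deriv (A.trans b c) (A.trans a b u) * deriv (A.trans a b) u = deriv (A.trans a c) u := by
  have h : A.trans a c =ᶠ[nhds u] A.trans b c ∘ A.trans a b := by
    filter_upwards [(A.isOpen_dom a b).mem_nhds hu] with v hv
    simp only [Function.comp, OrbiAtlas.trans]
    rw [(A.chart b).u.left_inv hv.2]
  rw [h.deriv_eq]
  exact (deriv_comp u
    ((A.trans_differentiableOn b c).differentiableAt
      ((A.isOpen_dom b c).mem_nhds (A.trans_mem_dom a b c hu hc)))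
    ((A.trans_differentiableOn a b).differentiableAt ((A.isOpen_dom a b).mem_nhds hu))).symm

theorem OrbiAtlas.deriv_trans_ne_zero (a b : ι) {u : ℂ} (hu : u ∈ A.dom a b) :
    deriv (A.trans a b) u ≠ 0 := by
  have haa : u ∈ A.dom a a := ⟨hu.1, (A.chart a).u.map_target hu.1⟩
  have h := A.deriv_trans_comp a b a hu haa
  rw [A.deriv_trans_self a hu.1] at h
  exact right_ne_zero_of_mul (h ▸ one_ne_zero)

theorem OrbiAtlas.Over.mem_dom {A : OrbiAtlas O ι} {a b : ι} {z w : ℂ} (h : A.Over a b z w) :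
    z ^ (A.chart a).ord ∈ A.dom a b :=
  ⟨h.1, by
    change (A.chart a).proj z ∈ (A.chart b).u.source
    rw [h.2.2.1]
    exact (A.chart b).u.map_target h.2.1⟩

theorem OrbiAtlas.Over.trans_eq {A : OrbiAtlas O ι} {a b : ι} {z w : ℂ} (h : A.Over a b z w) :
    A.trans a b (z ^ (A.chart a).ord) = w ^ (A.chart b).ord := by
  change (A.chart b).u ((A.chart a).proj z) = _
  rw [h.2.2.1]
  exact (A.chart b).u.right_inv h.2.1

/-- The log-canonical bundle `K_log = K ⊗ O(z₁) ⊗ ⋯ ⊗ O(z_k)`, pulled back to the orbifold.  Its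
frame on the chart `a` is `du / u` if the centre of `a` is marked and `du` otherwise. -/
def Klog : OrbiLineBundle A where
  weight _ := 0
  g a b z w := (A.chart b).logFactor (w ^ (A.chart b).ord) *
    deriv (fun u => (A.chart b).u ((A.chart a).u.symm u)) (z ^ (A.chart a).ord) /
      (A.chart a).logFactor (z ^ (A.chart a).ord)
  g_ne_zero a b z w h := by
    refine div_ne_zero (mul_ne_zero ?_ (A.deriv_trans_ne_zero a b h.mem_dom)) ?_
    · exact (A.chart b).logFactor_ne_zero (h.2.2.1 ▸ h.2.2.2 : (A.chart b).proj w ∉ O.marked)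
    · exact (A.chart a).logFactor_ne_zero h.2.2.2
  g_cocycle a b c z w v h h' := by
    have hb : (A.chart b).logFactor (w ^ (A.chart b).ord) ≠ 0 :=
      (A.chart b).logFactor_ne_zero h'.2.2.2
    have ha : (A.chart a).logFactor (z ^ (A.chart a).ord) ≠ 0 :=
      (A.chart a).logFactor_ne_zero h.2.2.2
    have hac : A.Over a c z v := ⟨h.1, h'.2.1, h.2.2.1.trans h'.2.2.1, h.2.2.2⟩
    have e := A.deriv_trans_comp a b c h.mem_dom hac.mem_dom
    rw [h.trans_eq] at e
    unfold OrbiAtlas.trans at e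
    rw [← e]
    field_simp
  g_action a z ζ hz hm hζ := by
    have ha : (A.chart a).logFactor (z ^ (A.chart a).ord) ≠ 0 := (A.chart a).logFactor_ne_zero hm
    have e := A.deriv_trans_self a hz
    unfold OrbiAtlas.trans at e
    rw [mul_pow, hζ, one_mul, e, mul_one, div_self ha, pow_zero]
  g_holo a b V l hV hVa hl hlb hp := by
    have hdom : ∀ z ∈ V, z ^ (A.chart a).ord ∈ A.dom a b := fun z hz =>
      ⟨hVa hz, by
        change (A.chart a).proj z ∈ (A.chart b).u.source
        rw [← hp z hz]
        exact (A.chart b).u.map_target (hlb hz)⟩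
    have hpow : DifferentiableOn ℂ (fun z : ℂ => z ^ (A.chart a).ord) V :=
      (differentiable_pow _).differentiableOn
    have hT := A.trans_differentiableOn a b
    have hT' := hT.deriv (A.isOpen_dom a b)
    have hl' : ∀ z ∈ V, l z ^ (A.chart b).ord = A.trans a b (z ^ (A.chart a).ord) := by
      intro z hz
      change _ = (A.chart b).u ((A.chart a).proj z)
      rw [← hp z hz]
      exact ((A.chart b).u.right_inv (hlb hz)).symm
    by_cases h : ∃ p, p ∈ (A.chart a).u.source ∧ p ∈ (A.chart b).u.source ∧ p ∈ O.marked
    · obtain ⟨p, hpa, hpb, hpm⟩ := h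
      have hca := (A.chart a).eq_center p hpa hpm
      have hcb := (A.chart b).eq_center p hpb hpm
      have hsymm : (A.chart a).u.symm 0 = p := by
        rw [← (A.chart a).u_center, ← hca, (A.chart a).u.left_inv hpa]
      have h0 : A.trans a b 0 = 0 := by
        unfold OrbiAtlas.trans
        rw [hsymm, hcb, (A.chart b).u_center]
      have h0d : (0 : ℂ) ∈ A.dom a b := by
        refine ⟨?_, ?_⟩
        · rw [← (A.chart a).u_center]
          exact (A.chart a).u.map_source (A.chart a).center_mem
        · simpa [hsymm] using hpb
      have hmul : ∀ u, u * dslope (A.trans a b) 0 u = A.trans a b u := by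
        intro u
        have := sub_smul_dslope (A.trans a b) 0 u
        simpa [h0] using this
      have hds : DifferentiableOn ℂ (dslope (A.trans a b) 0) (A.dom a b) :=
        (Complex.differentiableOn_dslope ((A.isOpen_dom a b).mem_nhds h0d)).2 hT
      have hds0 : ∀ u ∈ A.dom a b, dslope (A.trans a b) 0 u ≠ 0 := by
        intro u hu hz
        by_cases hu0 : u = 0
        · subst hu0
          rw [dslope_same] at hz
          exact A.deriv_trans_ne_zero a b hu hz
        · have h1 : A.trans a b u = 0 := by rw [← hmul, hz, mul_zero]
          have h2 : (A.chart a).u.symm u = p := by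
            have := (A.chart b).u.left_inv hu.2
            change (A.chart b).u.symm (A.trans a b u) = _ at this
            rw [← this, h1, ← (A.chart b).u_center, ← hcb, (A.chart b).u.left_inv hpb]
          apply hu0
          rw [← (A.chart a).u.right_inv hu.1, h2, hca, (A.chart a).u_center]
      refine ⟨fun z => deriv (A.trans a b) (z ^ (A.chart a).ord) /
        dslope (A.trans a b) 0 (z ^ (A.chart a).ord),
        (hT'.comp hpow hdom).div (hds.comp hpow hdom) fun z hz => hds0 _ (hdom z hz),
        fun z hz => div_ne_zero (A.deriv_trans_ne_zero a b (hdom z hz)) (hds0 _ (hdom z hz)), ?_⟩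
      intro z hz hzm
      have hu0 : z ^ (A.chart a).ord ≠ 0 := by
        intro h00
        apply hzm
        change (A.chart a).u.symm (z ^ (A.chart a).ord) ∈ _
        rw [h00, hsymm]
        exact hpm
      have hd := hds0 _ (hdom z hz)
      simp only [OrbiChart.logFactor, ← hca, ← hcb, hpm, if_true]
      rw [hl' z hz, ← hmul]
      change _ * deriv (A.trans a b) _ / _ = _
      field_simp
    · push Not at h
      have hna : ∀ u ∈ A.dom a b, (A.chart a).u.symm u ∉ O.marked := fun u hu =>
        h _ ((A.chart a).u.map_target hu.1) hu.2
      have hnb : ∀ u ∈ A.dom a b, (A.chart b).u.symm (A.trans a b u) ∉ O.marked := by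
        intro u hu
        rw [OrbiAtlas.trans, (A.chart b).u.left_inv hu.2]
        exact hna u hu
      refine ⟨fun z => (A.chart b).logFactor (A.trans a b (z ^ (A.chart a).ord)) *
        deriv (A.trans a b) (z ^ (A.chart a).ord) / (A.chart a).logFactor (z ^ (A.chart a).ord),
        ?_, ?_, ?_⟩
      · refine DifferentiableOn.div (DifferentiableOn.mul ?_ (hT'.comp hpow hdom)) ?_ ?_
        · exact (A.chart b).logFactor_differentiableOn.comp (hT.comp hpow hdom)
            fun z hz => hnb _ (hdom z hz)
        · exact (A.chart a).logFactor_differentiableOn.comp hpow fun z hz => hna _ (hdom z hz)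
        · exact fun z hz => (A.chart a).logFactor_ne_zero (hna _ (hdom z hz))
      · exact fun z hz => div_ne_zero (mul_ne_zero ((A.chart b).logFactor_ne_zero
          (hnb _ (hdom z hz))) (A.deriv_trans_ne_zero a b (hdom z hz)))
          ((A.chart a).logFactor_ne_zero (hna _ (hdom z hz)))
      · intro z hz _
        rw [hl' z hz]
        rfl

end Klog

/-- The Wirtinger derivative `∂f/∂z̄ = (∂f/∂x + i ∂f/∂y) / 2`. -/
def dbar (f : ℂ → ℂ) (z : ℂ) : ℂ := (fderiv ℝ f z 1 + Complex.I * fderiv ℝ f z Complex.I) / 2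

namespace OrbiLineBundle

variable {A} {L : OrbiLineBundle A}

/-- The local expression `Φ` of an isomorphism `φ : L ^ r ≅ K_log`: with `e` the frame of `L` on the
chart `a`, one has `φ (e ^ r) = Φ dz`.  (The frame of `K_log` is `logFactor u • du`, and `u = z ^ m`.) -/
def rootCoeff {r : ℕ} (φ : Iso (L.pow r) (Klog A)) (a : ι) (z : ℂ) : ℂ :=
  φ.toFun a z * (A.chart a).logFactor (z ^ (A.chart a).ord) *
    ((A.chart a).ord * z ^ ((A.chart a).ord - 1))

/-- The coefficient of `dz̄ ⊗ e` in `s̄ ^ (r - 1)`, at a point `z` of the chart `a` over an unmarked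
point.  For `s = f e`, the isomorphism `φ` makes `s ^ (r - 1)` the section `f ^ (r - 1) Φ dz ⊗ e⁻¹`
of `K ⊗ L⁻¹`; its conjugate is a section of `K̄ ⊗ L̄⁻¹`, and the metric identifies `L̄⁻¹` with `L`
by `ē⁻¹ = e / ‖e‖ ^ 2`. -/
def conjPow {r : ℕ} (φ : Iso (L.pow r) (Klog A)) (H : L.HermitianMetric) (s : L.SmoothSection)
    (a : ι) (z : ℂ) : ℂ :=
  (starRingEnd ℂ) (s.lift a z ^ (r - 1) * rootCoeff φ a z) / (H.weight a z : ℂ)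

/-- The spin equation `∂̄ s + s̄ ^ (r - 1) = 0`, an equation between `(0, 1)`-forms with values in
`L = |L|` on the complement of the (finitely many) marked points.  (When both sides extend
continuously over the marked points, as they do for a smooth metric on `|L|` and Neveu–Schwarz
marked points, the equation holds there as well.) -/
def SpinEquation {r : ℕ} (φ : Iso (L.pow r) (Klog A)) (H : L.HermitianMetric)
    (s : L.SmoothSection) : Prop :=
  ∀ a, ∀ z ∈ (A.chart a).cover, (A.chart a).proj z ∉ O.marked →
    dbar (s.lift a) z + conjPow φ H s a z = 0

end OrbiLineBundle

end Charts

end SpinCurve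

end

namespace SpinCurve

open MeasureTheory

/-! The proof integrates the `(1,0)`-form `ω = φ(s^r)`. Near a marked point `z ↦ z^m`, equivariance
of `φ` forces `m ∣ d r` (`Iso.ord_dvd`), and `d > 0` then gives `d r / m ≥ 1`. The zero `z^(d r) =
u^(d r / m)` of the `r`-th power of a section of `|L|` therefore absorbs the pole of `du/u`, and `ω`
is a `C¹` form on all of the surface (`exists_coeff_power`, `isOneZeroForm_power`).

Since `φ` is holomorphic, `∂̄ω = r s^(r-1) ∂̄s` read through `φ`. The spin equation turns its
coefficient in the coordinate `u` into `-r` times the squared norm of `s^(r-1)`, hence a nonpositive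
real number (`dbar_coeff_power`). By Stokes the integral of `∂̄ω` is zero
(`IsOneZeroForm.sum_integral_eq_zero`), so this coefficient vanishes identically, and with it `s`,
as `r ≥ 2`.

The metric enters only off the marked points. There, `ω` and its derivative are continuous and do
not involve it, so the sign passes to the marked points by density. -/

/-! ### Calculus of the Wirtinger derivative. -/

theorem dbar_congr {f g : ℂ → ℂ} {z : ℂ} (h : f =ᶠ[nhds z] g) : dbar f z = dbar g z := by
  rw [dbar, dbar, h.fderiv_eq]

theorem dbar_zero (z : ℂ) : dbar (fun _ => 0) z = 0 := by
  simp [dbar]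

theorem dbar_eq_zero_of_differentiableAt {f : ℂ → ℂ} {z : ℂ} (h : DifferentiableAt ℂ f z) :
    dbar f z = 0 := by
  rw [dbar, (h.hasFDerivAt.restrictScalars ℝ).fderiv]
  have e : (fderiv ℂ f z) Complex.I = Complex.I * (fderiv ℂ f z) 1 := by
    rw [← smul_eq_mul, ← map_smul, smul_eq_mul, mul_one]
  simp only [ContinuousLinearMap.coe_restrictScalars', e, ← mul_assoc, Complex.I_mul_I]
  ring

theorem dbar_mul {f g : ℂ → ℂ} {z : ℂ} (hf : DifferentiableAt ℝ f z)
    (hg : DifferentiableAt ℝ g z) :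
    dbar (fun w => f w * g w) z = dbar f z * g z + f z * dbar g z := by
  simp only [dbar, fderiv_fun_mul hf hg, add_apply,
    smul_apply, smul_eq_mul]
  ring

theorem dbar_mul_of_right {f g : ℂ → ℂ} {z : ℂ} (hf : DifferentiableAt ℝ f z)
    (hg : DifferentiableAt ℂ g z) :
    dbar (fun w => f w * g w) z = dbar f z * g z := by
  rw [dbar_mul hf (hg.restrictScalars ℝ), dbar_eq_zero_of_differentiableAt hg, mul_zero, add_zero]

theorem dbar_pow {f : ℂ → ℂ} {z : ℂ} (hf : DifferentiableAt ℝ f z) (n : ℕ) :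
    dbar (fun w => f w ^ n) z = n * f z ^ (n - 1) * dbar f z := by
  have h := fderiv_fun_pow (𝕜 := ℝ) n hf
  simp only [dbar, h, smul_apply, smul_eq_mul, nsmul_eq_mul]
  ring

/-- With `df = ∂f dz + ∂̄f dz̄`, pulling back by a holomorphic map multiplies `dz̄` by the conjugate
of `h'` and sends `dz` to a multiple of `dz`. -/
theorem dbar_comp {f h : ℂ → ℂ} {z h' : ℂ} (hf : DifferentiableAt ℝ f (h z))
    (hh : HasDerivAt h h' z) :
    dbar (fun w => f (h w)) z = dbar f (h z) * (starRingEnd ℂ) h' := by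
  have e : fderiv ℝ (fun w => f (h w)) z =
      (fderiv ℝ f (h z)).comp ((ContinuousLinearMap.toSpanSingleton ℂ h').restrictScalars ℝ) :=
    (hf.hasFDerivAt.comp z (hh.hasFDerivAt.restrictScalars ℝ)).fderiv
  have lin : ∀ w : ℂ, fderiv ℝ f (h z) w =
      w.re * fderiv ℝ f (h z) 1 + w.im * fderiv ℝ f (h z) Complex.I := by
    intro w
    have hw : w = w.re • (1 : ℂ) + w.im • Complex.I := by
      simp [Complex.re_add_im]
    conv_lhs => rw [hw]
    rw [map_add, map_smul, map_smul, Complex.real_smul, Complex.real_smul]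
  have hc : (starRingEnd ℂ) h' = h'.re - h'.im * Complex.I := by
    apply Complex.ext <;> simp
  simp only [dbar, e, ContinuousLinearMap.comp_apply, ContinuousLinearMap.coe_restrictScalars',
    ContinuousLinearMap.toSpanSingleton_apply, smul_eq_mul, one_mul]
  rw [lin h', lin (Complex.I * h'), hc]
  simp only [Complex.mul_re, Complex.mul_im, Complex.I_re, Complex.I_im, zero_mul, one_mul,
    zero_sub, zero_add]
  push_cast
  linear_combination (fderiv ℝ f (h z) Complex.I * h'.im / 2) * Complex.I_sq

theorem dbar_sum {α : Type*} (s : Finset α) {f : α → ℂ → ℂ} {z : ℂ}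
    (hf : ∀ i ∈ s, DifferentiableAt ℝ (f i) z) :
    dbar (fun w => ∑ i ∈ s, f i w) z = ∑ i ∈ s, dbar (f i) z := by
  simp only [dbar, fderiv_fun_sum hf, sum_apply, Finset.mul_sum,
    ← Finset.sum_add_distrib, Finset.sum_div]

theorem continuousOn_dbar {f : ℂ → ℂ} {U : Set ℂ} (hU : IsOpen U) (hf : ContDiffOn ℝ 1 f U) :
    ContinuousOn (dbar f) U := by
  have h := hf.continuousOn_fderiv_of_isOpen hU le_rfl
  unfold dbar
  exact ((h.clm_apply continuousOn_const).add
    (continuousOn_const.mul (h.clm_apply continuousOn_const))).div_const _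

/-! ### Integration over open subsets of `ℂ`. -/

theorem integral_fderiv_apply_eq_zero {f : ℂ → ℂ} (hf : ContDiff ℝ 1 f)
    (hc : HasCompactSupport f) (v : ℂ) : ∫ z, fderiv ℝ f z v = 0 := by
  have hi : Integrable (fun z => fderiv ℝ f z v) :=
    ((hf.continuous_fderiv one_ne_zero).clm_apply continuous_const).integrable_of_hasCompactSupport
      (hc.fderiv_apply (𝕜 := ℝ) v)
  -- Integration by parts against the constant `1`.
  have h := integral_mul_fderiv_eq_neg_fderiv_mul_of_integrable (μ := (volume : Measure ℂ))
    (f := fun _ : ℂ => (1 : ℂ)) (g := f) (v := v) (by simp) (by simpa using hi)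
    (by simpa using hf.continuous.integrable_of_hasCompactSupport hc)
    (fun x _ => differentiableAt_const _)
    (fun x _ => hf.differentiable one_ne_zero x)
  simpa using h

theorem integral_dbar_eq_zero {f : ℂ → ℂ} (hf : ContDiff ℝ 1 f) (hc : HasCompactSupport f) :
    ∫ z, dbar f z = 0 := by
  have hi : ∀ v, Integrable (fun z => fderiv ℝ f z v) := fun v =>
    ((hf.continuous_fderiv one_ne_zero).clm_apply continuous_const).integrable_of_hasCompactSupport
      (hc.fderiv_apply (𝕜 := ℝ) v)
  unfold dbar
  rw [integral_div, integral_add (hi _) ((hi _).const_mul _), integral_const_mul,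
    integral_fderiv_apply_eq_zero hf hc, integral_fderiv_apply_eq_zero hf hc]
  simp

theorem integrableOn_of_eq_zero_off_compact {f : ℂ → ℂ} {U K : Set ℂ} (hU : IsOpen U)
    (hK : IsCompact K) (hKU : K ⊆ U) (hf : ContinuousOn f U) (h0 : ∀ z ∈ U, z ∉ K → f z = 0) :
    IntegrableOn f U := by
  have h1 : IntegrableOn f K := (hf.mono hKU).integrableOn_compact hK
  exact h1.of_forall_sdiff_eq_zero hU.measurableSet fun z hz => h0 z hz.1 hz.2

/-- The integral of `∂̄ f` over an open set vanishes if `f` is supported in a compact subset. -/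
theorem setIntegral_dbar_eq_zero {f : ℂ → ℂ} {U K : Set ℂ} (hU : IsOpen U)
    (hK : IsCompact K) (hKU : K ⊆ U) (hf : ContDiffOn ℝ 1 f U) (h0 : ∀ z ∈ U, z ∉ K → f z = 0) :
    ∫ z in U, dbar f z = 0 := by
  classical
  -- The open sets `U` and `Kᶜ` cover `ℂ`. The extension of `f` by zero is locally `f` on the one
  -- and `0` on the other, hence `C¹` with compact support.
  have hind : ∀ z ∈ U, U.indicator f =ᶠ[nhds z] f := fun z hz => by
    filter_upwards [hU.mem_nhds hz] with w hw
    exact Set.indicator_of_mem hw f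
  have hout : ∀ z ∉ K, U.indicator f =ᶠ[nhds z] fun _ => 0 := fun z hz => by
    filter_upwards [hK.isClosed.isOpen_compl.mem_nhds hz] with w hw
    by_cases hwU : w ∈ U
    · rw [Set.indicator_of_mem hwU, h0 w hwU hw]
    · exact Set.indicator_of_notMem hwU f
  have hsm : ContDiff ℝ 1 (U.indicator f) := by
    rw [contDiff_iff_contDiffAt]
    intro z
    by_cases hz : z ∈ U
    · exact (hf.contDiffAt (hU.mem_nhds hz)).congr_of_eventuallyEq (hind z hz)
    · exact contDiffAt_const.congr_of_eventuallyEq (hout z fun h => hz (hKU h))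
  have hcs : HasCompactSupport (U.indicator f) :=
    HasCompactSupport.intro hK fun z hz => (hout z hz).self_of_nhds
  rw [← integral_dbar_eq_zero hsm hcs,
    ← setIntegral_eq_integral_of_forall_compl_eq_zero (s := U) (f := dbar (U.indicator f))]
  · exact setIntegral_congr_fun hU.measurableSet fun z hz => (dbar_congr (hind z hz)).symm
  · intro z hz
    rw [dbar_congr (hout z fun h => hz (hKU h)), dbar_zero]

/-- Change of variables under an injective holomorphic map. -/
theorem setIntegral_image_holomorphic {U : Set ℂ} {T : ℂ → ℂ} (hU : IsOpen U)
    (hT : DifferentiableOn ℂ T U) (hinj : Set.InjOn T U) (g : ℂ → ℂ) :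
    ∫ w in T '' U, g w = ∫ z in U, deriv T z * (starRingEnd ℂ) (deriv T z) * g (T z) := by
  have hd : ∀ z ∈ U, HasFDerivWithinAt T
      ((ContinuousLinearMap.toSpanSingleton ℂ (deriv T z)).restrictScalars ℝ) U z := fun z hz =>
    (((hT.differentiableAt (hU.mem_nhds hz)).hasDerivAt.hasFDerivAt.restrictScalars
      ℝ).hasFDerivWithinAt)
  rw [integral_image_eq_integral_abs_det_fderiv_smul volume hU.measurableSet hd hinj g]
  refine setIntegral_congr_fun hU.measurableSet fun z _ => ?_
  -- The real determinant of multiplication by a complex number is its norm from `ℂ` to `ℝ`.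
  have hdet : ((ContinuousLinearMap.toSpanSingleton ℂ (deriv T z)).restrictScalars ℝ).det =
      Complex.normSq (deriv T z) := by
    have h := LinearMap.det_restrictScalars (R := ℝ) (S := ℂ)
      (f := (ContinuousLinearMap.toSpanSingleton ℂ (deriv T z) : ℂ →ₗ[ℂ] ℂ))
    rw [LinearMap.det_ring] at h
    simp only [ContinuousLinearMap.coe_coe, ContinuousLinearMap.toSpanSingleton_apply,
      one_smul, Algebra.norm_complex_eq] at h
    exact h
  simp only [hdet, abs_of_nonneg (Complex.normSq_nonneg _), Complex.mul_conj, Complex.real_smul]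

/-! ### The underlying real smooth structure, on which partitions of unity live. -/

theorem contDiffGroupoid_real_of_complex {e : OpenPartialHomeomorph ℂ ℂ}
    (he : e ∈ contDiffGroupoid ω 𝓘(ℂ, ℂ)) : e ∈ contDiffGroupoid ∞ 𝓘(ℝ, ℂ) := by
  rw [contDiffGroupoid, mem_groupoid_of_pregroupoid] at he ⊢
  simp only [contDiffPregroupoid] at he ⊢
  simp only [modelWithCornersSelf_coe, modelWithCornersSelf_coe_symm, Set.preimage_id,
    Set.range_id, Set.inter_univ, Function.id_comp, Function.comp_id] at he ⊢
  exact ⟨(he.1.restrict_scalars ℝ).of_le le_top, (he.2.restrict_scalars ℝ).of_le le_top⟩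

section Surface

variable {X : Type*} [TopologicalSpace X] [ChartedSpace ℂ X]

variable (X) in
theorem isManifold_real [IsManifold 𝓘(ℂ, ℂ) ω X] : IsManifold 𝓘(ℝ, ℂ) ∞ X where
  compatible he he' := contDiffGroupoid_real_of_complex
    ((contDiffGroupoid ω 𝓘(ℂ, ℂ)).compatible he he')

theorem mem_maximalAtlas_real {e : OpenPartialHomeomorph X ℂ}
    (he : e ∈ IsManifold.maximalAtlas 𝓘(ℂ, ℂ) ω X) : e ∈ IsManifold.maximalAtlas 𝓘(ℝ, ℂ) ∞ X := by
  rw [IsManifold.maximalAtlas, mem_maximalAtlas_iff] at he ⊢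
  exact fun e' he' => ⟨contDiffGroupoid_real_of_complex (he e' he').1,
    contDiffGroupoid_real_of_complex (he e' he').2⟩

theorem differentiableOn_chart_change {e e' : OpenPartialHomeomorph X ℂ}
    (he : e ∈ IsManifold.maximalAtlas 𝓘(ℂ, ℂ) ω X)
    (he' : e' ∈ IsManifold.maximalAtlas 𝓘(ℂ, ℂ) ω X) :
    DifferentiableOn ℂ (fun u => e' (e.symm u)) (e.target ∩ e.symm ⁻¹' e'.source) := by
  have h3 : ContMDiffOn 𝓘(ℂ, ℂ) 𝓘(ℂ, ℂ) ω (fun u => e' (e.symm u))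
      (e.target ∩ e.symm ⁻¹' e'.source) :=
    (contMDiffOn_of_mem_maximalAtlas he').comp
      ((contMDiffOn_symm_of_mem_maximalAtlas he).mono Set.inter_subset_left) (fun z hz => hz.2)
  exact (contMDiffOn_iff_contDiffOn.1 h3).differentiableOn (by simp)

theorem contDiffOn_comp_symm [IsManifold 𝓘(ℂ, ℂ) ω X] {e : OpenPartialHomeomorph X ℂ}
    (he : e ∈ IsManifold.maximalAtlas 𝓘(ℂ, ℂ) ω X) {f : X → ℝ}
    (hf : ContMDiff 𝓘(ℝ, ℂ) 𝓘(ℝ, ℝ) ∞ f) :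
    ContDiffOn ℝ ∞ (fun u => (f (e.symm u) : ℂ)) e.target := by
  have h : ContMDiffOn 𝓘(ℝ, ℂ) 𝓘(ℝ, ℝ) ∞ (fun u => f (e.symm u)) e.target :=
    hf.comp_contMDiffOn (contMDiffOn_symm_of_mem_maximalAtlas (mem_maximalAtlas_real he))
  exact Complex.ofRealCLM.contDiff.comp_contDiffOn (contMDiffOn_iff_contDiffOn.1 h)

end Surface

/-- The image in the chart `e` of the support of a function supported in the source of `e`. -/
theorem isCompact_image_tsupport {X : Type*} [TopologicalSpace X] [CompactSpace X]
    (e : OpenPartialHomeomorph X ℂ) {f : X → ℝ} (hf : tsupport f ⊆ e.source) :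
    IsCompact (e '' tsupport f) ∧ e '' tsupport f ⊆ e.target ∧
      ∀ u ∈ e.target, u ∉ e '' tsupport f → (f (e.symm u) : ℂ) = 0 := by
  refine ⟨(isClosed_tsupport f).isCompact.image_of_continuousOn (e.continuousOn.mono hf), ?_, ?_⟩
  · rintro _ ⟨p, hp, rfl⟩
    exact e.map_source (hf hp)
  · intro u hu hn
    rw [image_eq_zero_of_notMem_tsupport fun h => hn ⟨_, h, e.right_inv hu⟩, Complex.ofReal_zero]

theorem dbar_comp_symm_eq_zero {X : Type*} [TopologicalSpace X]
    (e : OpenPartialHomeomorph X ℂ) {f : X → ℝ} {u : ℂ} (hu : u ∈ e.target)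
    (hn : e.symm u ∉ tsupport f) : dbar (fun v => (f (e.symm v) : ℂ)) u = 0 := by
  rw [← dbar_zero u]
  refine dbar_congr ?_
  have hc : ContinuousAt e.symm u := e.continuousAt_symm hu
  filter_upwards [hc ((isClosed_tsupport f).isOpen_compl.mem_nhds hn)] with v hv
  rw [image_eq_zero_of_notMem_tsupport hv, Complex.ofReal_zero]

/-! ### Stokes' theorem for `(1,0)`-forms on a compact Riemann surface. -/

section Stokes

variable {X : Type*} [TopologicalSpace X] [ChartedSpace ℂ X]

/-- A `(1, 0)`-form of class `C¹` on a Riemann surface, given by its coefficients in a family of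
holomorphic charts. -/
structure IsOneZeroForm {ι : Type*} (e : ι → OpenPartialHomeomorph X ℂ) (F : ι → ℂ → ℂ) :
    Prop where
  mem_maximalAtlas : ∀ a, e a ∈ IsManifold.maximalAtlas 𝓘(ℂ, ℂ) ω X
  contDiffOn : ∀ a, ContDiffOn ℝ 1 (F a) (e a).target
  compat : ∀ a b u, u ∈ (e a).target → (e a).symm u ∈ (e b).source →
    F a u = F b (e b ((e a).symm u)) * deriv (fun v => e b ((e a).symm v)) u

variable {ι : Type*} {e : ι → OpenPartialHomeomorph X ℂ} {F : ι → ℂ → ℂ}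

/-- The integral of `χ ∂̄η ∧ ω` does not depend on the chart in which it is computed. -/
theorem IsOneZeroForm.integral_eq [IsManifold 𝓘(ℂ, ℂ) ω X] (hF : IsOneZeroForm e F) {χ η : X → ℝ}
    (hη : ContMDiff 𝓘(ℝ, ℂ) 𝓘(ℝ, ℝ) ∞ η) {a b : ι} (ha : tsupport η ⊆ (e a).source)
    (hb : tsupport χ ⊆ (e b).source) :
    ∫ u in (e a).target, (χ ((e a).symm u) : ℂ) * (dbar (fun v => (η ((e a).symm v) : ℂ)) u * F a u)
      = ∫ u in (e b).target,
        (χ ((e b).symm u) : ℂ) * (dbar (fun v => (η ((e b).symm v) : ℂ)) u * F b u) := by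
  set U := (e a).target ∩ (e a).symm ⁻¹' (e b).source with hU
  set T : ℂ → ℂ := fun u => e b ((e a).symm u) with hT
  have hUo : IsOpen U := (e a).isOpen_inter_preimage_symm (e b).open_source
  have hTd : DifferentiableOn ℂ T U :=
    differentiableOn_chart_change (hF.mem_maximalAtlas a) (hF.mem_maximalAtlas b)
  have hinj : Set.InjOn T U := fun u hu v hv h =>
    (e a).symm.injOn hu.1 hv.1 ((e b).injOn hu.2 hv.2 h)
  have himg : T '' U ⊆ (e b).target := by
    rintro _ ⟨u, hu, rfl⟩
    exact (e b).map_source hu.2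
  have hTinv : ∀ u ∈ U, (e b).symm (T u) = (e a).symm u := fun u hu => (e b).left_inv hu.2
  -- Both integrands live on the overlap: in the chart `a` the factor `χ` vanishes elsewhere, in the
  -- chart `b` the factor `∂̄η` does.
  rw [setIntegral_eq_of_subset_of_forall_sdiff_eq_zero (s := U) (e a).open_target.measurableSet
      Set.inter_subset_left ?_,
    setIntegral_eq_of_subset_of_forall_sdiff_eq_zero (s := T '' U) (e b).open_target.measurableSet
      himg ?_,
    setIntegral_image_holomorphic hUo hTd hinj]
  · refine setIntegral_congr_fun hUo.measurableSet fun u hu => ?_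
    have hdiff : HasDerivAt T (deriv T u) u :=
      (hTd.differentiableAt (hUo.mem_nhds hu)).hasDerivAt
    have hηb : DifferentiableAt ℝ (fun v => (η ((e b).symm v) : ℂ)) (T u) :=
      ((contDiffOn_comp_symm (hF.mem_maximalAtlas b) hη).differentiableOn (by simp)
        ).differentiableAt ((e b).open_target.mem_nhds ((e b).map_source hu.2))
    have hd : dbar (fun v => (η ((e a).symm v) : ℂ)) u =
        dbar (fun v => (η ((e b).symm v) : ℂ)) (T u) * (starRingEnd ℂ) (deriv T u) := by
      rw [← dbar_comp hηb hdiff]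
      refine dbar_congr ?_
      filter_upwards [hUo.mem_nhds hu] with v hv
      rw [hTinv v hv]
    -- `∂̄η` contributes the conjugate of `T'` and `F` contributes `T'`; their product is the
    -- Jacobian.
    simp only [hTinv u hu, hd, hF.compat a b u hu.1 hu.2]
    change _ * (_ * (F b (T u) * deriv T u)) = _
    ring
  · rintro w ⟨hw, hn⟩
    have hwa : (e b).symm w ∉ (e a).source := fun h => hn
      ⟨e a ((e b).symm w), ⟨(e a).map_source h, by
        rw [Set.mem_preimage, (e a).left_inv h]; exact (e b).map_target hw⟩, by
        simp only [hT]
        rw [(e a).left_inv h, (e b).right_inv hw]⟩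
    rw [dbar_comp_symm_eq_zero (e b) hw fun h => hwa (ha h), zero_mul, mul_zero]
  · rintro u ⟨hu, hn⟩
    have hub : (e a).symm u ∉ (e b).source := fun h => hn ⟨hu, h⟩
    rw [image_eq_zero_of_notMem_tsupport fun h => hub (hb h), Complex.ofReal_zero, zero_mul]

/-- **Stokes' theorem** on a compact Riemann surface, for a `(1, 0)`-form: the integral of its
exterior derivative, computed with a partition of unity, vanishes. -/
theorem IsOneZeroForm.sum_integral_eq_zero [CompactSpace X] [IsManifold 𝓘(ℂ, ℂ) ω X]
    (hF : IsOneZeroForm e F)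
    (ρ : SmoothPartitionOfUnity ι 𝓘(ℝ, ℂ) X Set.univ)
    (hρ : ρ.IsSubordinate fun a => (e a).source) (J : Finset ι)
    (hJ : ∀ p, ∑ a ∈ J, ρ a p = 1) :
    ∑ a ∈ J, ∫ u in (e a).target, (ρ a ((e a).symm u) : ℂ) * dbar (F a) u = 0 := by
  have hR : ∀ a b, ContDiffOn ℝ ∞ (fun u => (ρ b ((e a).symm u) : ℂ)) (e a).target := fun a b =>
    contDiffOn_comp_symm (hF.mem_maximalAtlas a) (ρ b).contMDiff
  have hRd : ∀ a b, ∀ u ∈ (e a).target,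
      DifferentiableAt ℝ (fun u => (ρ b ((e a).symm u) : ℂ)) u := fun a b u hu =>
    ((hR a b).differentiableOn (by simp)).differentiableAt ((e a).open_target.mem_nhds hu)
  have hdR : ∀ a b, ContinuousOn (dbar fun u => (ρ b ((e a).symm u) : ℂ)) (e a).target :=
    fun a b => continuousOn_dbar (e a).open_target ((hR a b).of_le (by simp))
  have hFd : ∀ a, ∀ u ∈ (e a).target, DifferentiableAt ℝ (F a) u := fun a u hu =>
    ((hF.contDiffOn a).differentiableOn one_ne_zero).differentiableAt
      ((e a).open_target.mem_nhds hu)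
  have hdF : ∀ a, ContinuousOn (dbar (F a)) (e a).target := fun a =>
    continuousOn_dbar (e a).open_target (hF.contDiffOn a)
  have hsum : ∀ a u, ∑ b ∈ J, (ρ b ((e a).symm u) : ℂ) = 1 := fun a u => by
    exact_mod_cast hJ ((e a).symm u)
  have hdsum : ∀ a, ∀ u ∈ (e a).target,
      ∑ b ∈ J, dbar (fun v => (ρ b ((e a).symm v) : ℂ)) u = 0 := fun a u hu => by
    rw [← dbar_sum J fun b _ => hRd a b u hu]
    simp only [hsum]
    exact dbar_eq_zero_of_differentiableAt (differentiableAt_const 1)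
  have hdout : ∀ a, ∀ u ∈ (e a).target, u ∉ e a '' tsupport (ρ a) →
      dbar (fun v => (ρ a ((e a).symm v) : ℂ)) u = 0 := fun a u hu hn =>
    dbar_comp_symm_eq_zero (e a) hu fun h => hn ⟨_, h, (e a).right_inv hu⟩
  have hparts : ∀ a, ∫ u in (e a).target, (ρ a ((e a).symm u) : ℂ) * dbar (F a) u =
      - ∫ u in (e a).target, dbar (fun v => (ρ a ((e a).symm v) : ℂ)) u * F a u := by
    intro a
    obtain ⟨hK, hKt, hK0⟩ := isCompact_image_tsupport (e a) (hρ a)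
    have h := setIntegral_dbar_eq_zero (e a).open_target hK hKt
      (((hR a a).of_le (by simp)).mul (hF.contDiffOn a))
      fun u hu hn => by simp only [hK0 u hu hn, zero_mul]
    rw [setIntegral_congr_fun (e a).open_target.measurableSet
      fun u hu => dbar_mul (hRd a a u hu) (hFd a u hu), integral_add] at h
    · exact eq_neg_of_add_eq_zero_right h
    · exact integrableOn_of_eq_zero_off_compact (e a).open_target hK hKt
        ((hdR a a).mul (hF.contDiffOn a).continuousOn)
        fun u hu hn => by rw [hdout a u hu hn, zero_mul]
    · exact integrableOn_of_eq_zero_off_compact (e a).open_target hK hKt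
        ((hR a a).continuousOn.mul (hdF a))
        fun u hu hn => by simp only [hK0 u hu hn, zero_mul]
  -- Inserting `1 = ∑ ρ b` makes each term `ρ b ∂̄(ρ a) ∧ ω`, which can be computed in the chart `b`
  -- instead of `a`.
  have hsplit : ∀ a, ∫ u in (e a).target, dbar (fun v => (ρ a ((e a).symm v) : ℂ)) u * F a u =
      ∑ b ∈ J, ∫ u in (e a).target, (ρ b ((e a).symm u) : ℂ) *
        (dbar (fun v => (ρ a ((e a).symm v) : ℂ)) u * F a u) := by
    intro a
    obtain ⟨hK, hKt, -⟩ := isCompact_image_tsupport (e a) (hρ a)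
    rw [← integral_finsetSum]
    · simp only [← Finset.sum_mul, hsum, one_mul]
    · exact fun b _ => integrableOn_of_eq_zero_off_compact (e a).open_target hK hKt
        ((hR a b).continuousOn.mul ((hdR a a).mul (hF.contDiffOn a).continuousOn))
        fun u hu hn => by rw [hdout a u hu hn, zero_mul, mul_zero]
  -- With `b` fixed, everything is in one chart and `∑ ∂̄(ρ a) = ∂̄ 1 = 0`.
  have hmerge : ∀ b, ∑ a ∈ J, ∫ u in (e b).target, (ρ b ((e b).symm u) : ℂ) *
        (dbar (fun v => (ρ a ((e b).symm v) : ℂ)) u * F b u) = 0 := by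
    intro b
    obtain ⟨hK, hKt, hK0⟩ := isCompact_image_tsupport (e b) (hρ b)
    rw [← integral_finsetSum]
    · refine setIntegral_eq_zero_of_forall_eq_zero fun u hu => ?_
      rw [← Finset.mul_sum, ← Finset.sum_mul, hdsum b u hu, zero_mul, mul_zero]
    · exact fun a _ => integrableOn_of_eq_zero_off_compact (e b).open_target hK hKt
        ((hR b b).continuousOn.mul ((hdR b a).mul (hF.contDiffOn b).continuousOn))
        fun u hu hn => by simp only [hK0 u hu hn, zero_mul]
  simp only [hparts, hsplit, Finset.sum_neg_distrib, neg_eq_zero]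
  rw [Finset.sum_congr rfl fun a _ => Finset.sum_congr rfl fun b _ =>
    hF.integral_eq (ρ a).contMDiff (hρ a) (hρ b), Finset.sum_comm]
  exact Finset.sum_eq_zero fun b _ => hmerge b

/-- If the `∂̄`-derivative of a `(1, 0)`-form on a compact Riemann surface has nonpositive real
part, then the real part vanishes: at each point, this is seen in at least one of the charts. -/
theorem IsOneZeroForm.exists_re_dbar_eq_zero [T2Space X] [CompactSpace X]
    [IsManifold 𝓘(ℂ, ℂ) ω X] (hF : IsOneZeroForm e F)
    (hcov : ∀ p, ∃ a, p ∈ (e a).source)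
    (hneg : ∀ a, ∀ u ∈ (e a).target, (dbar (F a) u).re ≤ 0) (p : X) :
    ∃ a, p ∈ (e a).source ∧ (dbar (F a) (e a p)).re = 0 := by
  have := isManifold_real X
  obtain ⟨ρ, hρ⟩ := SmoothPartitionOfUnity.exists_isSubordinate 𝓘(ℝ, ℂ) (isClosed_univ (X := X))
    (fun a => (e a).source) (fun a => (e a).open_source)
    fun p _ => Set.mem_iUnion.2 (hcov p)
  -- Compactness leaves finitely many nonzero members of the partition, so the family of charts may
  -- be infinite.
  have hfin := ρ.locallyFinite.finite_nonempty_of_compact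
  set J := hfin.toFinset with hJdef
  have hJ : ∀ p, ∑ a ∈ J, ρ a p = 1 := fun p => by
    rw [← ρ.sum_eq_one (Set.mem_univ p), finsum_eq_sum_of_support_subset]
    intro a ha
    simp only [hJdef, Set.Finite.coe_toFinset]
    exact ⟨p, ha⟩
  have hzero := hF.sum_integral_eq_zero ρ hρ J hJ
  have hcont : ∀ a, ContinuousOn
      (fun u => (ρ a ((e a).symm u) : ℂ) * dbar (F a) u) (e a).target := fun a =>
    (contDiffOn_comp_symm (hF.mem_maximalAtlas a) (ρ a).contMDiff).continuousOn.mul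
      (continuousOn_dbar (e a).open_target (hF.contDiffOn a))
  have hint : ∀ a, IntegrableOn (fun u => (ρ a ((e a).symm u) : ℂ) * dbar (F a) u)
      (e a).target := fun a => by
    obtain ⟨hK, hKt, hK0⟩ := isCompact_image_tsupport (e a) (hρ a)
    exact integrableOn_of_eq_zero_off_compact (e a).open_target hK hKt (hcont a)
      fun u hu hn => by simp only [hK0 u hu hn, zero_mul]
  have hre : ∀ a, (∫ u in (e a).target, (ρ a ((e a).symm u) : ℂ) * dbar (F a) u).re =
      - ∫ u in (e a).target, -((ρ a ((e a).symm u) : ℂ) * dbar (F a) u).re := fun a => by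
    rw [integral_neg, neg_neg]
    exact (integral_re (hint a)).symm
  have hnn : ∀ a, ∀ u ∈ (e a).target, 0 ≤ -((ρ a ((e a).symm u) : ℂ) * dbar (F a) u).re := by
    intro a u hu
    rw [Complex.re_ofReal_mul]
    have := mul_nonneg (ρ.nonneg a ((e a).symm u)) (neg_nonneg.2 (hneg a u hu))
    linarith
  have hae : ∀ a, 0 ≤ᵐ[volume.restrict (e a).target]
      fun u => -((ρ a ((e a).symm u) : ℂ) * dbar (F a) u).re := fun a =>
    (ae_restrict_iff' (e a).open_target.measurableSet).2 (Filter.Eventually.of_forall (hnn a))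
  have hsum0 : ∑ a ∈ J, ∫ u in (e a).target,
      -((ρ a ((e a).symm u) : ℂ) * dbar (F a) u).re = 0 := by
    have h := congrArg Complex.re hzero
    rw [Complex.re_sum] at h
    simpa only [hre, Finset.sum_neg_distrib, neg_eq_zero, Complex.zero_re] using h
  rw [Finset.sum_eq_zero_iff_of_nonneg fun a _ => integral_nonneg_of_ae (hae a)] at hsum0
  -- The weighted integrand can only be divided by `ρ a` where it is nonzero; this selects the chart
  -- in the conclusion.
  obtain ⟨a, haJ, hap⟩ : ∃ a ∈ J, ρ a p ≠ 0 :=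
    Finset.exists_ne_zero_of_sum_ne_zero (by rw [hJ p]; exact one_ne_zero)
  have hps : p ∈ (e a).source := hρ a (subset_tsupport _ hap)
  refine ⟨a, hps, ?_⟩
  have hintr : IntegrableOn (fun u => -((ρ a ((e a).symm u) : ℂ) * dbar (F a) u).re)
      (e a).target := (hint a).re.neg
  have h0 := (setIntegral_eq_zero_iff_of_nonneg_ae (hae a) hintr).1 (hsum0 a haJ)
  -- Continuity upgrades almost everywhere vanishing to vanishing at `p` itself.
  have h1 := Measure.eqOn_open_of_ae_eq h0 (e a).open_target
    (Complex.continuous_re.comp_continuousOn (hcont a)).neg continuousOn_const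
    ((e a).map_source hps)
  simp only [Pi.zero_apply, (e a).left_inv hps, Complex.re_ofReal_mul, neg_eq_zero,
    mul_eq_zero] at h1
  exact h1.resolve_left hap

end Stokes

/-! ### Descent along `z ↦ z ^ m`. -/

/-- A holomorphic function which is invariant under the `m`-th roots of unity is a holomorphic
function of `z ^ m`. -/
theorem exists_holomorphic_descent {m : ℕ} (hm : m ≠ 0) {V : Set ℂ} (hV : IsOpen V) {f : ℂ → ℂ}
    (hf : DifferentiableOn ℂ f {z | z ^ m ∈ V})
    (hinv : ∀ z ζ, z ^ m ∈ V → ζ ^ m = 1 → f (ζ * z) = f z) :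
    ∃ h : ℂ → ℂ, DifferentiableOn ℂ h V ∧ ∀ z, z ^ m ∈ V → h (z ^ m) = f z := by
  have hUo : IsOpen {z : ℂ | z ^ m ∈ V} := hV.preimage (continuous_pow m)
  have hroot : ∀ u : ℂ, (u ^ (m⁻¹ : ℂ)) ^ m = u := fun u => Complex.cpow_nat_inv_pow u hm
  have hind : ∀ z w : ℂ, z ^ m ∈ V → w ^ m = z ^ m → f w = f z := by
    intro z w hz hw
    by_cases hz0 : z = 0
    · subst hz0
      rw [zero_pow hm] at hw
      rw [eq_zero_of_pow_eq_zero hw]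
    · rw [← hinv z (w / z) hz (by rw [div_pow, hw, div_self (pow_ne_zero _ hz0)]),
        div_mul_cancel₀ _ hz0]
  have key : ∀ z, z ^ m ∈ V → f ((z ^ m) ^ (m⁻¹ : ℂ)) = f z := fun z hz =>
    hind z _ hz (hroot _)
  refine ⟨fun u => f (u ^ (m⁻¹ : ℂ)), ?_, key⟩
  have hne : ∀ u ∈ V, u ≠ 0 → DifferentiableAt ℂ (fun u => f (u ^ (m⁻¹ : ℂ))) u := by
    intro u₀ hu₀ h0
    set z₀ := u₀ ^ (m⁻¹ : ℂ) with hz₀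
    -- The principal root may jump at `u₀`. This branch is holomorphic there because `u / u₀` is
    -- near `1`, and by invariance `f` does not see which root is used.
    have hb : DifferentiableAt ℂ (fun u : ℂ => z₀ * (u / u₀) ^ (m⁻¹ : ℂ)) u₀ :=
      (((differentiableAt_id.div_const u₀).cpow_const (by
        simp [div_self h0, Complex.one_mem_slitPlane])).const_mul z₀)
    have hbm : ∀ u, (z₀ * (u / u₀) ^ (m⁻¹ : ℂ)) ^ m = u := fun u => by
      rw [mul_pow, hroot, hroot, mul_div_cancel₀ _ h0]
    have hfd : DifferentiableAt ℂ f (z₀ * (u₀ / u₀) ^ (m⁻¹ : ℂ)) :=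
      hf.differentiableAt (hUo.mem_nhds (by
        rw [Set.mem_ofPred_eq, hbm]; exact hu₀))
    refine (hfd.comp u₀ hb).congr_of_eventuallyEq ?_
    filter_upwards [hV.mem_nhds hu₀] with u hu
    exact hind _ _ ((hbm u).symm ▸ hu) (by rw [hroot, hbm])
  by_cases h0V : (0 : ℂ) ∈ V
  -- At `0` the singularity is removable: the principal root is continuous there.
  · refine (Complex.differentiableOn_compl_singleton_and_continuousAt_iff
      (hV.mem_nhds h0V)).1 ⟨fun u hu => (hne u hu.1 hu.2).differentiableWithinAt, ?_⟩
    have hpos : 0 < ((m : ℂ)⁻¹).re := by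
      rw [← Complex.ofReal_natCast, ← Complex.ofReal_inv, Complex.ofReal_re]
      positivity
    have hz : (0 : ℂ) ^ (m⁻¹ : ℂ) = 0 := Complex.zero_cpow (by simpa using hm)
    have hc : ContinuousAt (fun u : ℂ => u ^ (m⁻¹ : ℂ)) 0 :=
      (Complex.continuousAt_cpow_zero_of_re_pos hpos).comp
        (f := fun u : ℂ => (u, (m⁻¹ : ℂ))) (by fun_prop)
    refine ContinuousAt.comp (g := f) ?_ hc
    refine (hf.differentiableAt (hUo.mem_nhds ?_)).continuousAt
    rw [Set.mem_ofPred_eq, hz, zero_pow hm]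
    exact h0V
  · exact fun u hu => (hne u hu fun h => h0V (h ▸ hu)).differentiableWithinAt

/-! ### Uniformizing charts and their unmarked points. -/

section Charts

variable {X : Type*} [TopologicalSpace X] [ChartedSpace ℂ X] {O : OrbifoldStructure X}

namespace OrbiChart

variable (c : OrbiChart O)

theorem ord_ne_zero : c.ord ≠ 0 := Nat.one_le_iff_ne_zero.1 (O.one_le_ord _)

theorem ord_eq_one (h : c.center ∉ O.marked) : c.ord = 1 := O.ord_of_not_marked h

theorem isOpen_cover : IsOpen c.cover := c.u.open_target.preimage (continuous_pow _)

theorem eq_zero_of_marked {u : ℂ} (hu : u ∈ c.u.target) (h : c.u.symm u ∈ O.marked) : u = 0 := by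
  rw [← c.u.right_inv hu, c.eq_center _ (c.u.map_target hu) h, c.u_center]

theorem symm_zero : c.u.symm 0 = c.center := by
  rw [← c.u_center, c.u.left_inv c.center_mem]

theorem zero_mem_target : (0 : ℂ) ∈ c.u.target := by
  rw [← c.u_center]
  exact c.u.map_source c.center_mem

theorem ne_zero_of_not_marked (hc : c.center ∈ O.marked) {z : ℂ} (hz : c.proj z ∉ O.marked) :
    z ≠ 0 := by
  rintro rfl
  apply hz
  rw [proj, zero_pow c.ord_ne_zero, c.symm_zero]
  exact hc

/-- Only `0` can be marked in a chart. This density carries identities and inequalities across the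
marked points by continuity. -/
theorem subset_closure_not_marked {V : Set ℂ} (hV : IsOpen V) (hVt : V ⊆ c.u.target) :
    V ⊆ closure (V ∩ {u | c.u.symm u ∉ O.marked}) := by
  refine ((dense_compl_singleton (0 : ℂ)).open_subset_closure_inter hV).trans (closure_mono ?_)
  exact fun u hu => ⟨hu.1, fun h => hu.2 (c.eq_zero_of_marked (hVt hu.1) h)⟩

theorem exists_lift {u : ℂ} (hu : u ∈ c.u.target) :
    ∃ z ∈ c.cover, z ^ c.ord = u ∧ c.proj z = c.u.symm u := by
  have h : (u ^ ((c.ord : ℂ)⁻¹)) ^ c.ord = u := Complex.cpow_nat_inv_pow u c.ord_ne_zero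
  refine ⟨_, ?_, h, ?_⟩
  · rw [cover, Set.mem_ofPred_eq, h]
    exact hu
  · rw [proj, h]

theorem deriv_pow_ne_zero {z : ℂ} (hz : c.proj z ∉ O.marked) :
    (c.ord : ℂ) * z ^ (c.ord - 1) ≠ 0 := by
  refine mul_ne_zero (Nat.cast_ne_zero.2 c.ord_ne_zero) ?_
  by_cases h : c.center ∈ O.marked
  · exact pow_ne_zero _ (c.ne_zero_of_not_marked h hz)
  · simp [c.ord_eq_one h]

theorem isOpen_unmarked_cover : IsOpen {z | z ∈ c.cover ∧ c.proj z ∉ O.marked} := by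
  by_cases h : c.center ∈ O.marked
  · convert c.isOpen_cover.inter (isOpen_compl_singleton (x := (0 : ℂ))) using 1
    ext z
    exact ⟨fun hz => ⟨hz.1, c.ne_zero_of_not_marked h hz.2⟩,
      fun hz => ⟨hz.1, fun hm => hz.2 (eq_zero_of_pow_eq_zero (c.eq_zero_of_marked hz.1 hm))⟩⟩
  · convert c.isOpen_cover using 1
    ext z
    exact ⟨fun hz => hz.1,
      fun hz => ⟨hz, fun hm => h (c.eq_center _ (c.u.map_target hz) hm ▸ hm)⟩⟩

end OrbiChart

variable {ι : Type*} {A : OrbiAtlas O ι} {L : OrbiLineBundle A} {r : ℕ}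

/-! ### The form `φ(s^r)` and the spin equation. -/

namespace OrbiLineBundle

/-- Compatibility of `φ` for two lifts of one point in a single chart; `Klog` has weight `0`, so
only the weight of `L ^ r` appears. -/
theorem Iso.toFun_mul_zeta (φ : Iso (L.pow r) (Klog A)) (a : ι) {z ζ : ℂ}
    (hz : z ∈ (A.chart a).cover) (hm : (A.chart a).proj z ∉ O.marked)
    (hζ : ζ ^ (A.chart a).ord = 1) :
    φ.toFun a (ζ * z) * ζ ^ (L.weight a * r) = φ.toFun a z := by
  have hp : (ζ * z) ^ (A.chart a).ord = z ^ (A.chart a).ord := by rw [mul_pow, hζ, one_mul]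
  have hpr : (A.chart a).proj (ζ * z) = (A.chart a).proj z := by
    simp only [OrbiChart.proj, hp]
  have hover : A.Over a a (ζ * z) z := ⟨by
    rw [OrbiChart.cover, Set.mem_ofPred_eq, hp]; exact hz, hz, hpr, hpr ▸ hm⟩
  have h := φ.compat a a _ _ hover
  rw [(Klog A).g_action a z ζ hz hm hζ, (L.pow r).g_action a z ζ hz hm hζ] at h
  simpa [pow, Klog] using h

/-- The origin is fixed by the local group and `φ` is nonzero there, so a primitive root `ζ` must
satisfy `ζ ^ (weight * r) = 1`. Equivariance reaches the origin by continuity. -/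
theorem Iso.ord_dvd (φ : Iso (L.pow r) (Klog A)) (a : ι) :
    (A.chart a).ord ∣ L.weight a * r := by
  set c := A.chart a with hc
  obtain ⟨ζ, hζ⟩ : ∃ ζ : ℂ, IsPrimitiveRoot ζ c.ord :=
    ⟨_, Complex.isPrimitiveRoot_exp c.ord c.ord_ne_zero⟩
  have hmem : ∀ z ∈ c.cover, ζ * z ∈ c.cover := fun z hz => by
    rw [OrbiChart.cover, Set.mem_ofPred_eq, mul_pow, hζ.pow_eq_one, one_mul]
    exact hz
  have h0 : (0 : ℂ) ∈ c.cover := by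
    rw [OrbiChart.cover, Set.mem_ofPred_eq, zero_pow c.ord_ne_zero]
    exact c.zero_mem_target
  have heq : Set.EqOn (fun z => φ.toFun a (ζ * z) * ζ ^ (L.weight a * r)) (φ.toFun a) c.cover := by
    refine Set.EqOn.of_subset_closure (s := c.cover ∩ {0}ᶜ) ?_ ?_ (φ.holo a).continuousOn
      Set.inter_subset_left
      ((dense_compl_singleton (0 : ℂ)).open_subset_closure_inter c.isOpen_cover)
    · intro z hz
      refine φ.toFun_mul_zeta a hz.1 (fun h => hz.2 ?_) hζ.pow_eq_one
      exact eq_zero_of_pow_eq_zero (c.eq_zero_of_marked hz.1 h)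
    · exact ((φ.holo a).continuousOn.comp (continuous_const_mul ζ).continuousOn hmem).mul
        continuousOn_const
  have h := heq h0
  simp only [mul_zero] at h
  exact hζ.dvd_of_pow_eq_one _ (mul_left_cancel₀ (φ.ne_zero a 0 h0) (h.trans (mul_one _).symm))

theorem Iso.toFun_invariant (φ : Iso (L.pow r) (Klog A)) (a : ι) {z ζ : ℂ}
    (hz : z ∈ (A.chart a).cover) (hζ : ζ ^ (A.chart a).ord = 1) :
    φ.toFun a (ζ * z) = φ.toFun a z := by
  by_cases hm : (A.chart a).proj z ∈ O.marked
  · rw [eq_zero_of_pow_eq_zero ((A.chart a).eq_zero_of_marked hz hm), mul_zero]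
  · obtain ⟨k, hk⟩ := φ.ord_dvd a
    have h := φ.toFun_mul_zeta a hz hm hζ
    rwa [hk, pow_mul, hζ, one_pow, mul_one] at h

theorem pow_wt_ne_zero (L : OrbiLineBundle A) (a : ι) {z : ℂ}
    (hz : (A.chart a).proj z ∉ O.marked) : z ^ L.wt a ≠ 0 := by
  by_cases h : (A.chart a).center ∈ O.marked
  · exact pow_ne_zero _ ((A.chart a).ne_zero_of_not_marked h hz)
  · simp [wt, (A.chart a).ord_eq_one h, Nat.mod_one]

/-- At Neveu–Schwarz points, the pole of the frame of `K_log` is cancelled by the zeros of the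
`r`-th powers of sections of `L`. -/
theorem pow_wt_mul_logFactor (φ : Iso (L.pow r) (Klog A)) (hr : r ≠ 0) (hNS : L.AllNeveuSchwarz)
    (a : ι) {z : ℂ} (hz : (A.chart a).proj z ∉ O.marked) :
    (z ^ L.wt a) ^ r * (A.chart a).logFactor (z ^ (A.chart a).ord) =
      (z ^ (A.chart a).ord) ^ (L.wt a * r / (A.chart a).ord - 1) := by
  set c := A.chart a with hc
  by_cases h : c.center ∈ O.marked
  · have hdvd : c.ord ∣ L.wt a * r := by
      have h1 := φ.ord_dvd a
      rwa [Nat.dvd_iff_mod_eq_zero, Nat.mul_mod, ← Nat.mod_mod (L.weight a), ← Nat.mul_mod,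
        ← Nat.dvd_iff_mod_eq_zero] at h1
    obtain ⟨k, hk⟩ := hdvd
    have hk0 : k ≠ 0 := by
      rintro rfl
      -- This is where the Neveu–Schwarz condition is needed: the exponent `k - 1` is a genuine
      -- subtraction.
      exact (Nat.mul_pos (hNS a h) (Nat.pos_of_ne_zero hr)).ne' (hk.trans (mul_zero _))
    obtain ⟨j, rfl⟩ := Nat.exists_eq_succ_of_ne_zero hk0
    have hz0 : z ≠ 0 := c.ne_zero_of_not_marked h hz
    rw [← pow_mul, hk, Nat.mul_div_cancel_left _ (Nat.pos_of_ne_zero c.ord_ne_zero), pow_mul,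
      OrbiChart.logFactor, if_pos h, Nat.succ_eq_add_one, Nat.add_sub_cancel, pow_succ,
      mul_assoc, mul_inv_cancel₀ (pow_ne_zero _ hz0), mul_one]
  -- At an unmarked centre the exponent is the truncated `0 - 1 = 0`, matching the frame factor `1`.
  · have hw : L.wt a = 0 := by rw [wt, ← hc, c.ord_eq_one h, Nat.mod_one]
    simp [hw, OrbiChart.logFactor, h]

/-- For a section `s` of `|L|`, the `1`-form `φ (s ^ r)` is smooth across Neveu–Schwarz points. -/
theorem exists_coeff_power (φ : Iso (L.pow r) (Klog A)) (hr : r ≠ 0) (hNS : L.AllNeveuSchwarz)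
    (s : L.SmoothSection) (a : ι) :
    ∃ F : ℂ → ℂ, ContDiffOn ℝ 1 F (A.chart a).u.target ∧
      ∀ z ∈ (A.chart a).cover, (A.chart a).proj z ∉ O.marked →
        F (z ^ (A.chart a).ord) =
          s.lift a z ^ r * (φ.toFun a z * (A.chart a).logFactor (z ^ (A.chart a).ord)) := by
  obtain ⟨h, hh, he⟩ := exists_holomorphic_descent (A.chart a).ord_ne_zero
    (A.chart a).u.open_target (φ.holo a) fun z ζ hz hζ => φ.toFun_invariant a hz hζ
  refine ⟨fun u => u ^ (L.wt a * r / (A.chart a).ord - 1) * (s.toFun a u ^ r * h u), ?_, ?_⟩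
  · have hhs : ContDiffOn ℝ 1 h (A.chart a).u.target :=
      (hh.contDiffOn (A.chart a).u.open_target).restrict_scalars ℝ
    exact (contDiff_id.pow _).contDiffOn.mul
      ((((s.smooth a).of_le (by simp)).pow r).mul hhs)
  · intro z hz hm
    simp only [← pow_wt_mul_logFactor φ hr hNS a hm, he z hz, SmoothSection.lift, mul_pow]
    ring

theorem SmoothSection.lift_compat (s : L.SmoothSection) {a b : ι} {z w : ℂ}
    (h : A.Over a b z w) : s.lift a z = L.g a b z w * s.lift b w :=
  s.compat a b z w h

theorem SmoothSection.differentiableAt_lift (s : L.SmoothSection) (a : ι) {z : ℂ}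
    (hz : z ∈ (A.chart a).cover) : DifferentiableAt ℝ (s.lift a) z := by
  have hs : DifferentiableAt ℝ (s.toFun a) (z ^ (A.chart a).ord) :=
    ((s.smooth a).differentiableOn (by simp)).differentiableAt
      ((A.chart a).u.open_target.mem_nhds hz)
  have hp : DifferentiableAt ℝ (fun z : ℂ => z ^ (A.chart a).ord) z := differentiableAt_id.pow _
  exact (differentiableAt_id.pow _).mul (hs.comp z hp)

/-- Under the spin equation, `∂̄ φ (s ^ r)` is a nonpositive multiple of the squared norm of
`s ^ (r - 1)`. -/
theorem dbar_coeff_power {φ : Iso (L.pow r) (Klog A)} {H : L.HermitianMetric}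
    {s : L.SmoothSection} (hs : SpinEquation φ H s) {a : ι} {F : ℂ → ℂ}
    (hF : ContDiffOn ℝ 1 F (A.chart a).u.target)
    (hFe : ∀ z ∈ (A.chart a).cover, (A.chart a).proj z ∉ O.marked →
        F (z ^ (A.chart a).ord) =
          s.lift a z ^ r * (φ.toFun a z * (A.chart a).logFactor (z ^ (A.chart a).ord)))
    {z : ℂ} (hz : z ∈ (A.chart a).cover) (hm : (A.chart a).proj z ∉ O.marked) :
    (dbar F (z ^ (A.chart a).ord)).re = - (r * Complex.normSq (s.lift a z ^ (r - 1) *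
      (φ.toFun a z * (A.chart a).logFactor (z ^ (A.chart a).ord))) / H.weight a z) := by
  set c := A.chart a with hc
  set D : ℂ := c.ord * z ^ (c.ord - 1) with hD
  have hD0 : (starRingEnd ℂ) D ≠ 0 := by
    rw [Ne, map_eq_zero]
    exact c.deriv_pow_ne_zero hm
  have hFd : DifferentiableAt ℝ F (z ^ c.ord) :=
    (hF.differentiableOn one_ne_zero).differentiableAt (c.u.open_target.mem_nhds hz)
  -- `∂̄` of the pullback is computed twice: by the chain rule here, and by the Leibniz rule in
  -- `h2`. The spin equation also carries the conjugate of `D`, from `φ(e^r) = q D dz`, so this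
  -- factor cancels.
  have h1 : dbar (fun w => F (w ^ c.ord)) z = dbar F (z ^ c.ord) * (starRingEnd ℂ) D :=
    dbar_comp hFd (hasDerivAt_pow c.ord z)
  set q : ℂ → ℂ := fun z => φ.toFun a z * c.logFactor (z ^ c.ord) with hq
  have hqd : DifferentiableAt ℂ q z := by
    refine DifferentiableOn.differentiableAt (s := {z | z ∈ c.cover ∧ c.proj z ∉ O.marked}) ?_
      (c.isOpen_unmarked_cover.mem_nhds ⟨hz, hm⟩)
    exact ((φ.holo a).mono fun z hz => hz.1).mul
      (c.logFactor_differentiableOn.comp (differentiable_pow _).differentiableOn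
        fun z hz => hz.2)
  have hsd := s.differentiableAt_lift a hz
  have h2 : dbar (fun w => F (w ^ c.ord)) z =
      r * s.lift a z ^ (r - 1) * dbar (s.lift a) z * q z := by
    rw [dbar_congr (g := fun w => s.lift a w ^ r * q w),
      dbar_mul_of_right (hsd.fun_pow r) hqd, dbar_pow hsd]
    filter_upwards [c.isOpen_unmarked_cover.mem_nhds ⟨hz, hm⟩] with w hw
    exact hFe w hw.1 hw.2
  have h3 : dbar (s.lift a) z = - conjPow φ H s a z := eq_neg_of_add_eq_zero_left (hs a z hz hm)
  have h4 : conjPow φ H s a z =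
      (starRingEnd ℂ) (s.lift a z ^ (r - 1) * q z) * (starRingEnd ℂ) D / H.weight a z := by
    simp only [conjPow, rootCoeff, hq, ← hc, hD, map_mul]
    ring
  have h5 : dbar F (z ^ c.ord) =
      ((- (r * Complex.normSq (s.lift a z ^ (r - 1) * q z) / H.weight a z) : ℝ) : ℂ) := by
    refine mul_right_cancel₀ hD0 ?_
    rw [← h1, h2, h3, h4]
    push_cast
    rw [← Complex.mul_conj]
    ring
  rw [h5, Complex.ofReal_re]

/-- Off the marked points, the transition factors of `s^r` and `φ` leave exactly that of `du`; both
sides are continuous, so the rule extends over the marked points. -/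
theorem isOneZeroForm_power [IsManifold 𝓘(ℂ, ℂ) ω X] (φ : Iso (L.pow r) (Klog A))
    (s : L.SmoothSection) {F : ι → ℂ → ℂ}
    (hF : ∀ a, ContDiffOn ℝ 1 (F a) (A.chart a).u.target)
    (hFe : ∀ a, ∀ z ∈ (A.chart a).cover, (A.chart a).proj z ∉ O.marked →
        F a (z ^ (A.chart a).ord) =
          s.lift a z ^ r * (φ.toFun a z * (A.chart a).logFactor (z ^ (A.chart a).ord))) :
    IsOneZeroForm (fun a => (A.chart a).u) F where
  mem_maximalAtlas a := (A.chart a).mem_maximalAtlas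
  contDiffOn := hF
  compat a b := by
    have hT := A.trans_differentiableOn a b
    have hmaps : Set.MapsTo (A.trans a b) (A.dom a b) (A.chart b).u.target := fun u hu =>
      (A.chart b).u.map_source hu.2
    have heq : Set.EqOn (F a) (fun u => F b (A.trans a b u) * deriv (A.trans a b) u)
        (A.dom a b) := by
      refine Set.EqOn.of_subset_closure ?_ ((hF a).continuousOn.mono Set.inter_subset_left)
        (((hF b).continuousOn.comp hT.continuousOn hmaps).mul
          (hT.deriv (A.isOpen_dom a b)).continuousOn) Set.inter_subset_left
        ((A.chart a).subset_closure_not_marked (A.isOpen_dom a b) Set.inter_subset_left)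
      rintro u ⟨hu, hum⟩
      obtain ⟨z, hz, rfl, hzp⟩ := (A.chart a).exists_lift hu.1
      obtain ⟨w, hw, hwe, hwp⟩ := (A.chart b).exists_lift (hmaps hu)
      have hpw : (A.chart a).proj z = (A.chart b).proj w := by
        rw [hzp, hwp]
        exact ((A.chart b).u.left_inv hu.2).symm
      have hzm : (A.chart a).proj z ∉ O.marked := hzp ▸ hum
      have hover : A.Over a b z w := ⟨hz, hw, hpw, hzm⟩
      have hla := (A.chart a).logFactor_ne_zero hum
      have hφ := φ.compat a b z w hover
      simp only [pow, Klog] at hφ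
      change _ = F b (A.trans a b (z ^ (A.chart a).ord)) * _
      rw [hover.trans_eq, hFe a z hz hzm, hFe b w hw (hpw ▸ hzm), s.lift_compat hover, mul_pow]
      change _ = _ * deriv (fun u => (A.chart b).u ((A.chart a).u.symm u)) _
      rw [div_mul_eq_mul_div, eq_div_iff hla] at hφ
      linear_combination (s.lift b w ^ r) * hφ
    exact fun u hu hub => heq ⟨hu, hub⟩

theorem isZero_of_spinEquation [T2Space X] [CompactSpace X] [IsManifold 𝓘(ℂ, ℂ) ω X] (hr : 2 ≤ r)
    (φ : Iso (L.pow r) (Klog A)) (hNS : L.AllNeveuSchwarz) (H : L.HermitianMetric)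
    (s : L.SmoothSection) (hs : SpinEquation φ H s) : s.IsZero := by
  choose F hF hFe using exists_coeff_power φ (by omega) hNS s
  have hform := isOneZeroForm_power φ s hF hFe
  have hneg : ∀ a, ∀ u ∈ (A.chart a).u.target, (dbar (F a) u).re ≤ 0 := by
    intro a u hu
    have hcl := (A.chart a).subset_closure_not_marked (A.chart a).u.open_target le_rfl hu
    have hcont := Complex.continuous_re.comp_continuousOn
      (continuousOn_dbar (A.chart a).u.open_target (hF a))
    refine closure_minimal (s := Set.Iic (0 : ℝ)) (t := Set.Iic 0) le_rfl isClosed_Iic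
      (((hcont u hu).mono Set.inter_subset_left).mem_closure hcl ?_)
    rintro v ⟨hv, hvm⟩
    obtain ⟨z, hz, rfl, hzp⟩ := (A.chart a).exists_lift hv
    have hzm : (A.chart a).proj z ∉ O.marked := hzp ▸ hvm
    simp only [Set.mem_Iic, Function.comp_apply, dbar_coeff_power hs (hF a) (hFe a) hz hzm]
    have := H.pos a z hz hzm
    exact neg_nonpos.2 (div_nonneg (mul_nonneg (Nat.cast_nonneg _) (Complex.normSq_nonneg _))
      this.le)
  intro a
  refine Set.EqOn.of_subset_closure (g := fun _ => 0) ?_ (s.smooth a).continuousOn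
    continuousOn_const Set.inter_subset_left
    ((A.chart a).subset_closure_not_marked (A.chart a).u.open_target le_rfl)
  rintro u ⟨hu, hum⟩
  -- The vanishing is obtained in some chart `b`, perhaps not `a`; the transition function of `L`
  -- carries it back.
  obtain ⟨b, hb, hb0⟩ := hform.exists_re_dbar_eq_zero A.covers hneg ((A.chart a).u.symm u)
  obtain ⟨z, hz, rfl, hzp⟩ := (A.chart a).exists_lift hu
  obtain ⟨w, hw, hwe, hwp⟩ := (A.chart b).exists_lift ((A.chart b).u.map_source hb)
  rw [(A.chart b).u.left_inv hb] at hwp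
  have hwm : (A.chart b).proj w ∉ O.marked := hwp ▸ hum
  have hover : A.Over a b z w := ⟨hz, hw, hzp.trans hwp.symm, hzp ▸ hum⟩
  simp only [← hwe] at hb0
  rw [dbar_coeff_power hs (hF b) (hFe b) hw hwm, neg_eq_zero, div_eq_zero_iff, mul_eq_zero,
    Nat.cast_eq_zero, Complex.normSq_eq_zero, mul_eq_zero, mul_eq_zero] at hb0
  have hw0 : s.lift b w = 0 := by
    rcases hb0 with (h | h | h | h) | h
    · omega
    · exact eq_zero_of_pow_eq_zero h
    · exact absurd h (φ.ne_zero b w hw)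
    · exact absurd h ((A.chart b).logFactor_ne_zero hwm)
    · exact absurd h (H.pos b w hw hwm).ne'
  have hz0 : s.lift a z = 0 := by rw [s.lift_compat hover, hw0, mul_zero]
  exact (mul_eq_zero.1 hz0).resolve_left (pow_wt_ne_zero L a (hzp ▸ hum))

theorem spinEquation_of_isZero (hr : 2 ≤ r) (φ : Iso (L.pow r) (Klog A)) (H : L.HermitianMetric)
    (s : L.SmoothSection) (hs : s.IsZero) : SpinEquation φ H s := by
  intro a z hz _
  have h0 : ∀ w ∈ (A.chart a).cover, s.lift a w = 0 := fun w hw => by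
    rw [SmoothSection.lift, hs a _ hw, mul_zero]
  have hd : dbar (s.lift a) z = 0 := by
    rw [← dbar_zero z]
    refine dbar_congr ?_
    filter_upwards [(A.chart a).isOpen_cover.mem_nhds hz] with w hw
    exact h0 w hw
  rw [hd, conjPow, h0 z hz, zero_pow (by omega), zero_mul, map_zero, zero_div, add_zero]

end OrbiLineBundle

end Charts

end SpinCurve

open SpinCurve in
theorem lemma5p2p6 {X : Type*} [TopologicalSpace X] [T2Space X] [CompactSpace X]
    [ChartedSpace ℂ X] [IsManifold 𝓘(ℂ, ℂ) ω X]
    (O : OrbifoldStructure X) {ι : Type*} (A : OrbiAtlas O ι)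
    (r : ℕ) (hr : 2 ≤ r)
    (L : OrbiLineBundle A) (φ : OrbiLineBundle.Iso (L.pow r) (Klog A))
    (hNS : L.AllNeveuSchwarz)
    (H : L.HermitianMetric) (s : L.SmoothSection) :
    OrbiLineBundle.SpinEquation φ H s ↔ s.IsZero :=
  ⟨OrbiLineBundle.isZero_of_spinEquation hr φ hNS H s,
    OrbiLineBundle.spinEquation_of_isZero hr φ H s⟩
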